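/- Let $\pi\colon E\to M$ be a smooth fibre bundle over a smooth manifold $M$, let $\mathcal E(M)$ be the space of its smooth sections, and let $\mathcal E(M\times\mathbb R)$ be the space of smooth sections of the induced bundle $\pi\times\mathrm{id}\colon E\times\mathbb R\to M\times\mathbb R$; such a section $u$ is regarded as a family $u_t=u(\cdot,t)$ of sections of $\pi$, with velocity $\dot u$. The space $\Omega^k(\mathcal E(M))$ of $k$-forms consists of finite sums of formal integrals $\omega=\int_Q\alpha\,d\mu$. Here $Q$ is a manifold with a locally finite Borel measure $\mu$ and finitely many (at least one), jointly proper, smooth evaluation maps $x_i\colon Q\to M$ (for example $Q=M^r$ with a smooth density and the $r$ projections; diagonals of $M^r$ account for $\delta$-functions, and constant $x_i$ for point functionals). The integrand $\alpha$ is a $k$-form on the space of sections, smoothly depending on $q\in Q$, whose value at $q$ depends only on jets, of a finite order, of the section $u$ and of its variations $\delta u$ at the points $x_i(q)$; forms on the space of sections are given by their compatible pull-backs to smooth finite-dimensional families of sections. Formal integrals of total divergences on $Q$ are set equal to zero, and formal integrals that differ by a change of the integration variables and a renumbering of the points $x_i$ are identified. The exterior variation $\delta\colon\Omega^k\to\Omega^{k+1}$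 is the exterior derivative of the integrand with respect to $u$. Define $K\colon\Omega^{k+1}(\mathcal E(M))\to\Omega^{k}(\mathcal E(M\times\mathbb R))$ as the interior product with $\dot u$ followed by formal integration over $t$: $$K\int_Q\alpha\,d\mu=\int_{Q\times\mathbb R}\bigl(i_{\dot u}\alpha\bigr)\big|_{u=u_t}\,d\mu\,dt,$$ in coordinates $K\omega=\int d^nx\,dt\;\dot u^i(x,t)\,\dfrac{\delta\omega}{\delta(\delta u^i(x))}$, and put $K=0$ on $\Omega^0(\mathcal E(M))$. Then $K$ anticommutes with the exterior variation in every degree: $$\delta K+K\delta=0 .$$ That is, $\delta K\omega=-K\delta\omega$ for every $\omega\in\Omega^{k}(\mathcal E(M))$ with $k\ge 1$, and $K\delta\omega=0$ for every $\omega\in\Omega^0(\mathcal E(M))$. -/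

import Mathlib

open scoped Manifold ContDiff Topology DirectSum
open MeasureTheory

universe u

namespace FieldForms

noncomputable section

/-! ### Fields: sections of a smooth map, smooth families of sections, contact of jets -/

/-- `π : E → M` is a smooth fibre bundle with typical fibre `Φ`: it is smooth and every point of
the base lies in the base set of a local trivialization that is smooth in both directions. -/
structure IsSmoothFiberBundle
    {EM HM M EE HE E EF HF : Type u}
    [NormedAddCommGroup EM] [NormedSpace ℝ EM] [TopologicalSpace HM]
    [NormedAddCommGroup EE] [NormedSpace ℝ EE] [TopologicalSpace HE]
    [NormedAddCommGroup EF] [NormedSpace ℝ EF] [TopologicalSpace HF]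
    [TopologicalSpace M] [ChartedSpace HM M] [TopologicalSpace E] [ChartedSpace HE E]
    (IM : ModelWithCorners ℝ EM HM) (IE : ModelWithCorners ℝ EE HE)
    (IF : ModelWithCorners ℝ EF HF) (Φ : Type u) [TopologicalSpace Φ] [ChartedSpace HF Φ]
    (π : E → M) : Prop where
  contMDiff : ContMDiff IE IM ∞ π
  exists_trivialization : ∀ x : M, ∃ e : Bundle.Trivialization Φ π, x ∈ e.baseSet ∧
    ContMDiffOn IE (IM.prod IF) ∞ e e.source ∧
    ContMDiffOn (IM.prod IF) IE ∞ e.toOpenPartialHomeomorph.symm e.target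

section Fields

variable {EM HM M EE HE E : Type u}
  [NormedAddCommGroup EM] [NormedSpace ℝ EM] [TopologicalSpace HM]
  [NormedAddCommGroup EE] [NormedSpace ℝ EE] [TopologicalSpace HE]
  [TopologicalSpace M] [ChartedSpace HM M] [TopologicalSpace E] [ChartedSpace HE E]

/-- A field: a smooth section of `π : E → M`. The type of fields is the space `𝓔(M)`. -/
structure Field (IM : ModelWithCorners ℝ EM HM) (IE : ModelWithCorners ℝ EE HE)
    (π : E → M) where
  toFun : M → E
  contMDiff : ContMDiff IM IE ∞ toFun
  section_eq : ∀ x, π (toFun x) = x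

/-- A smooth `d`-parameter family of fields `u_v`, `v ∈ ℝ^d` (a plot of the space of fields):
`u_v(x)` is smooth in `(v, x)`. -/
structure Family (IM : ModelWithCorners ℝ EM HM) (IE : ModelWithCorners ℝ EE HE)
    (π : E → M) (d : ℕ) where
  field : (Fin d → ℝ) → Field IM IE π
  contMDiff : ContMDiff (𝓘(ℝ, Fin d → ℝ).prod IM) IE ∞
    (fun p : (Fin d → ℝ) × M => (field p.1).toFun p.2)

variable {IM : ModelWithCorners ℝ EM HM} {IE : ModelWithCorners ℝ EE HE} {π : E → M}

/-- The map `(v, x) ↦ u_v(x)` of a family of fields. -/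
def Family.ev {d : ℕ} (P : Family IM IE π d) : (Fin d → ℝ) × M → E :=
  fun p => (P.field p.1).toFun p.2

/-- Change of parameters in a family of fields. -/
def Family.comp {d e : ℕ} (P : Family IM IE π d) (φ : (Fin e → ℝ) → (Fin d → ℝ))
    (hφ : ContDiff ℝ ∞ φ) : Family IM IE π e where
  field w := P.field (φ w)
  contMDiff := P.contMDiff.comp
    ((hφ.contMDiff.comp contMDiff_fst).prodMk contMDiff_snd)

end Fields

/-- The maps `f` and `g` have the same `r`-jet at `p`: along every smooth curve through `p`, and
composed with any smooth function on the target, they agree to order `r`. -/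
def SameJet {EN HN N EN' HN' N' : Type*}
    [NormedAddCommGroup EN] [NormedSpace ℝ EN] [TopologicalSpace HN]
    [NormedAddCommGroup EN'] [NormedSpace ℝ EN'] [TopologicalSpace HN']
    [TopologicalSpace N] [ChartedSpace HN N] [TopologicalSpace N'] [ChartedSpace HN' N']
    (I : ModelWithCorners ℝ EN HN) (I' : ModelWithCorners ℝ EN' HN')
    (r : ℕ) (f g : N → N') (p : N) : Prop :=
  ∀ γ : ℝ → N, ContMDiff 𝓘(ℝ, ℝ) I ∞ γ → γ 0 = p →
    ∀ h : N' → ℝ, ContMDiff I' 𝓘(ℝ, ℝ) ∞ h →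
      ∀ j ≤ r, iteratedDeriv j (fun s => h (f (γ s))) 0 = iteratedDeriv j (fun s => h (g (γ s))) 0

/-! ### Domains of formal integration -/

/-- A domain of formal multi-point integration over `M`: a manifold `Q` with a locally finite
Borel measure, and finitely many smooth evaluation maps `x_i : Q → M`, jointly proper.
Basic examples are `Q = M^k` with a smooth density and the `k` projections `x_i`; point functionals
arise when `Q` is a point or when some `x_i` are constant; `δ`-functions of distinct integration
points are absorbed by passing to diagonals `Q ⊆ M^k` (or by letting the measure be carried by
a diagonal). -/
structure Domain {EM HM : Type u} [NormedAddCommGroup EM] [NormedSpace ℝ EM]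
    [TopologicalSpace HM] (IM : ModelWithCorners ℝ EM HM)
    (M : Type u) [TopologicalSpace M] [ChartedSpace HM M] where
  EQ : Type u
  [normedAddCommGroup : NormedAddCommGroup EQ]
  [normedSpace : NormedSpace ℝ EQ]
  [finiteDimensional : FiniteDimensional ℝ EQ]
  HQ : Type u
  [topologicalSpaceModel : TopologicalSpace HQ]
  I : ModelWithCorners ℝ EQ HQ
  [boundaryless : I.Boundaryless]
  Q : Type u
  [topologicalSpace : TopologicalSpace Q]
  [t2Space : T2Space Q]
  [secondCountable : SecondCountableTopology Q]
  [chartedSpace : ChartedSpace HQ Q]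
  [isManifold : IsManifold I ∞ Q]
  [measurableSpace : MeasurableSpace Q]
  [borelSpace : BorelSpace Q]
  μ : Measure Q
  [locallyFinite : IsLocallyFiniteMeasure μ]
  ι : Type
  [fintype : Fintype ι]
  [nonempty : Nonempty ι]
  x : ι → Q → M
  contMDiff_x : ∀ i, ContMDiff I IM ∞ (x i)
  proper_x : IsProperMap (fun q i => x i q)

attribute [instance] Domain.normedAddCommGroup Domain.normedSpace Domain.finiteDimensional
  Domain.topologicalSpaceModel Domain.boundaryless Domain.topologicalSpace Domain.t2Space
  Domain.secondCountable Domain.chartedSpace Domain.isManifold Domain.measurableSpace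
  Domain.borelSpace Domain.locallyFinite Domain.fintype Domain.nonempty

/-- The domain `Q × ℝ` over `M × ℝ`, with measure `dμ dt` and evaluation maps
`(q, t) ↦ (x_i(q), t)`: all points are taken at the same time `t`. -/
def Domain.timesLine {EM HM : Type u} [NormedAddCommGroup EM] [NormedSpace ℝ EM]
    [TopologicalSpace HM] {IM : ModelWithCorners ℝ EM HM}
    {M : Type u} [TopologicalSpace M] [ChartedSpace HM M] [T2Space M]
    (c : Domain IM M) : Domain (IM.prod 𝓘(ℝ, ℝ)) (M × ℝ) where
  EQ := c.EQ × ℝ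
  HQ := ModelProd c.HQ ℝ
  I := c.I.prod 𝓘(ℝ, ℝ)
  Q := c.Q × ℝ
  μ := c.μ.prod volume
  ι := c.ι
  x i p := (c.x i p.1, p.2)
  contMDiff_x i := ((c.contMDiff_x i).comp contMDiff_fst).prodMk contMDiff_snd
  proper_x := by
    have h1 : IsProperMap (Prod.map (fun q i => c.x i q) (id : ℝ → ℝ)) :=
      c.proper_x.prodMap isProperMap_id
    have h2 : IsProperMap
        (fun (p : (c.ι → M) × ℝ) (i : c.ι) => ((p.1 i, p.2) : M × ℝ)) := by
      have hl : Function.LeftInverse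
          (fun y : c.ι → M × ℝ => ((fun i => (y i).1, (y (Classical.arbitrary c.ι)).2) :
            (c.ι → M) × ℝ))
          (fun (p : (c.ι → M) × ℝ) (i : c.ι) => ((p.1 i, p.2) : M × ℝ)) := fun p => rfl
      exact (hl.isClosedEmbedding (by fun_prop) (by fun_prop)).isProperMap
    exact h2.comp h1

/-! ### Local integrands -/

section Forms

variable {EM HM M EE HE E : Type u}
  [NormedAddCommGroup EM] [NormedSpace ℝ EM] [TopologicalSpace HM]
  [NormedAddCommGroup EE] [NormedSpace ℝ EE] [TopologicalSpace HE]
  [TopologicalSpace M] [ChartedSpace HM M] [TopologicalSpace E] [ChartedSpace HE E]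

/-- An assignment, to every finite-dimensional family of fields `u_v`, `v ∈ ℝ^d`, and every
`q ∈ Q`, of an alternating `k`-form on the parameter space `ℝ^d`. -/
abbrev PreIntegrand (IM : ModelWithCorners ℝ EM HM) (IE : ModelWithCorners ℝ EE HE)
    (π : E → M) (Q : Type u) (k : ℕ) : Type u :=
  ∀ d : ℕ, Family IM IE π d → (Fin d → ℝ) → Q → (Fin d → ℝ) [⋀^Fin k]→L[ℝ] ℝ

/-- `α` is a `k`-form on the space of fields, given by its pull-backs to finite-dimensional
families, that depends on a parameter `q ∈ Q` and is local: at `q` it depends only on a finite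
jet of the field and of its variations at the points `x_i(q)`.

* `smooth`: the pull-backs are smooth in the parameters and in `q`;
* `pullback`: they are compatible with changes of parameters;
* `finite_order`: there is `r` (the differential order) such that the pull-back to a family at `v`
  depends only on the `r`-jets of the map `(v, x) ↦ u_v(x)` at the points `(v, x_i(q))`; similarly
  its partial derivatives in `v` up to order `s` depend only on the `(r + s)`-jets. -/
structure IsLocal {IM : ModelWithCorners ℝ EM HM} {IE : ModelWithCorners ℝ EE HE} {π : E → M}
    (c : Domain IM M) {k : ℕ} (α : PreIntegrand IM IE π c.Q k) : Prop where
  smooth : ∀ (d : ℕ) (P : Family IM IE π d),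
    ContMDiff (𝓘(ℝ, Fin d → ℝ).prod c.I) 𝓘(ℝ, (Fin d → ℝ) [⋀^Fin k]→L[ℝ] ℝ) ∞
      (fun p : (Fin d → ℝ) × c.Q => α d P p.1 p.2)
  pullback : ∀ (d e : ℕ) (P : Family IM IE π d) (φ : (Fin e → ℝ) → (Fin d → ℝ))
    (hφ : ContDiff ℝ ∞ φ) (w : Fin e → ℝ) (q : c.Q),
    α e (P.comp φ hφ) w q = (α d P (φ w) q).compContinuousLinearMap (fderiv ℝ φ w)
  finite_order : ∃ r : ℕ, ∀ (d : ℕ) (P P' : Family IM IE π d) (v : Fin d → ℝ) (q : c.Q) (s : ℕ),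
    (∀ i, SameJet (𝓘(ℝ, Fin d → ℝ).prod IM) IE (r + s) P.ev P'.ev (v, c.x i q)) →
      ∀ j ≤ s, iteratedFDeriv ℝ j (fun w => α d P w q) v =
        iteratedFDeriv ℝ j (fun w => α d P' w q) v

theorem SameJet.mono {EN HN N EN' HN' N' : Type*}
    [NormedAddCommGroup EN] [NormedSpace ℝ EN] [TopologicalSpace HN]
    [NormedAddCommGroup EN'] [NormedSpace ℝ EN'] [TopologicalSpace HN']
    [TopologicalSpace N] [ChartedSpace HN N] [TopologicalSpace N'] [ChartedSpace HN' N']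
    {I : ModelWithCorners ℝ EN HN} {I' : ModelWithCorners ℝ EN' HN'}
    {r r' : ℕ} {f g : N → N'} {p : N} (h : SameJet I I' r f g p) (hr : r' ≤ r) :
    SameJet I I' r' f g p :=
  fun γ hγ h0 φ hφ j hj => h γ hγ h0 φ hφ j (hj.trans hr)

variable {IM : ModelWithCorners ℝ EM HM} {IE : ModelWithCorners ℝ EE HE} {π : E → M}

theorem IsLocal.contDiff {c : Domain IM M} {k : ℕ} {α : PreIntegrand IM IE π c.Q k}
    (h : IsLocal c α) {d : ℕ} (P : Family IM IE π d) (q : c.Q) :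
    ContDiff ℝ ∞ (fun v => α d P v q) :=
  ((h.smooth d P).comp (contMDiff_id.prodMk contMDiff_const)).contDiff

variable (IE π) in
/-- The vector space of local `k`-form integrands on a domain of integration. -/
def Integrand (c : Domain IM M) (k : ℕ) : Submodule ℝ (PreIntegrand IM IE π c.Q k) where
  carrier := {α | IsLocal c α}
  zero_mem' :=
    { smooth := fun _ _ => contMDiff_const
      pullback := fun _ _ _ _ _ _ _ => by ext; rfl
      finite_order := ⟨0, fun _ _ _ _ _ _ _ _ _ => rfl⟩ }
  add_mem' := by
    intro α β hα hβ
    refine ⟨fun d P => (hα.smooth d P).add (hβ.smooth d P), fun d e P φ hφ w q => ?_, ?_⟩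
    · have h1 := hα.pullback d e P φ hφ w q
      have h2 := hβ.pullback d e P φ hφ w q
      change α e (P.comp φ hφ) w q + β e (P.comp φ hφ) w q = _
      rw [h1, h2]
      rfl
    · obtain ⟨r₁, h₁⟩ := hα.finite_order
      obtain ⟨r₂, h₂⟩ := hβ.finite_order
      refine ⟨max r₁ r₂, fun d P P' v q s h j hj => ?_⟩
      have e1 := h₁ d P P' v q s (fun i => (h i).mono (by omega)) j hj
      have e2 := h₂ d P P' v q s (fun i => (h i).mono (by omega)) j hj
      have key : ∀ R : Family IM IE π d, iteratedFDeriv ℝ j (fun w => (α + β) d R w q) v =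
          iteratedFDeriv ℝ j (fun w => α d R w q) v +
            iteratedFDeriv ℝ j (fun w => β d R w q) v := fun R =>
        iteratedFDeriv_add_apply ((hα.contDiff R q).contDiffAt.of_le (by exact_mod_cast le_top))
          ((hβ.contDiff R q).contDiffAt.of_le (by exact_mod_cast le_top))
      rw [key, key, e1, e2]
  smul_mem' := by
    intro a α hα
    refine ⟨fun d P => (contDiff_const_smul a).contMDiff.comp (hα.smooth d P), fun d e P φ hφ w q => ?_, ?_⟩
    · have h1 := hα.pullback d e P φ hφ w q
      change a • α e (P.comp φ hφ) w q = _
      rw [h1]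
      rfl
    · obtain ⟨r₁, h₁⟩ := hα.finite_order
      refine ⟨r₁, fun d P P' v q s h j hj => ?_⟩
      have e1 := h₁ d P P' v q s h j hj
      have key : ∀ R : Family IM IE π d, iteratedFDeriv ℝ j (fun w => (a • α) d R w q) v =
          a • iteratedFDeriv ℝ j (fun w => α d R w q) v := fun R =>
        iteratedFDeriv_const_smul_apply (a := a) (f := fun w => α d R w q)
          ((hα.contDiff R q).contDiffAt.of_le (by exact_mod_cast le_top))
      rw [key, key, e1]

/-! ### The exterior variation of integrands -/

theorem contMDiff_partial_fderiv {EN HN N : Type*}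
    [NormedAddCommGroup EN] [NormedSpace ℝ EN] [TopologicalSpace HN]
    [TopologicalSpace N] [ChartedSpace HN N] {I : ModelWithCorners ℝ EN HN} [IsManifold I ∞ N]
    {d k : ℕ} {f : (Fin d → ℝ) → N → (Fin d → ℝ) [⋀^Fin k]→L[ℝ] ℝ}
    (hf : ContMDiff (𝓘(ℝ, Fin d → ℝ).prod I) 𝓘(ℝ, (Fin d → ℝ) [⋀^Fin k]→L[ℝ] ℝ) ∞
      (fun p : (Fin d → ℝ) × N => f p.1 p.2)) :
    ContMDiff (𝓘(ℝ, Fin d → ℝ).prod I)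
      𝓘(ℝ, (Fin d → ℝ) →L[ℝ] ((Fin d → ℝ) [⋀^Fin k]→L[ℝ] ℝ)) ∞
      (fun p : (Fin d → ℝ) × N => fderiv ℝ (fun v => f v p.2) p.1) := by
  intro p
  have h := ContMDiffAt.mfderiv (x₀ := p) (m := ∞) (n := ∞) (I := 𝓘(ℝ, Fin d → ℝ))
    (I' := 𝓘(ℝ, (Fin d → ℝ) [⋀^Fin k]→L[ℝ] ℝ)) (J := 𝓘(ℝ, Fin d → ℝ).prod I)
    (fun (p : (Fin d → ℝ) × N) v => f v p.2) (fun p => p.1)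
    ((hf.comp ((contMDiff_snd (I := 𝓘(ℝ, Fin d → ℝ).prod I) (J := 𝓘(ℝ, Fin d → ℝ))).prodMk
      (contMDiff_snd.comp contMDiff_fst))).contMDiffAt)
    contMDiff_fst.contMDiffAt (by simp)
  simpa [inTangentCoordinates_model_space, mfderiv_eq_fderiv] using h

/-- The partial exterior derivative of a jointly smooth family of forms is jointly smooth. -/
theorem contMDiff_extDeriv {EN HN N : Type*}
    [NormedAddCommGroup EN] [NormedSpace ℝ EN] [TopologicalSpace HN]
    [TopologicalSpace N] [ChartedSpace HN N] {I : ModelWithCorners ℝ EN HN} [IsManifold I ∞ N]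
    {d k : ℕ} {f : (Fin d → ℝ) → N → (Fin d → ℝ) [⋀^Fin k]→L[ℝ] ℝ}
    (hf : ContMDiff (𝓘(ℝ, Fin d → ℝ).prod I) 𝓘(ℝ, (Fin d → ℝ) [⋀^Fin k]→L[ℝ] ℝ) ∞
      (fun p : (Fin d → ℝ) × N => f p.1 p.2)) :
    ContMDiff (𝓘(ℝ, Fin d → ℝ).prod I) 𝓘(ℝ, (Fin d → ℝ) [⋀^Fin (k + 1)]→L[ℝ] ℝ) ∞
      (fun p : (Fin d → ℝ) × N => extDeriv (fun v => f v p.2) p.1) :=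
  (ContinuousAlternatingMap.alternatizeUncurryFinCLM ℝ (Fin d → ℝ) ℝ).contMDiff.comp
    (contMDiff_partial_fderiv hf)

theorem iteratedFDeriv_extDeriv_congr {d k : ℕ}
    {f g : (Fin d → ℝ) → (Fin d → ℝ) [⋀^Fin k]→L[ℝ] ℝ} (hf : ContDiff ℝ ∞ f)
    (hg : ContDiff ℝ ∞ g) {v : Fin d → ℝ} {j : ℕ}
    (h : iteratedFDeriv ℝ (j + 1) f v = iteratedFDeriv ℝ (j + 1) g v) :
    iteratedFDeriv ℝ j (extDeriv f) v = iteratedFDeriv ℝ j (extDeriv g) v := by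
  rw [iteratedFDeriv_succ_eq_comp_right, iteratedFDeriv_succ_eq_comp_right] at h
  have h' := (continuousMultilinearCurryRightEquiv' ℝ j (Fin d → ℝ)
    ((Fin d → ℝ) [⋀^Fin k]→L[ℝ] ℝ)).symm.injective h
  have key : ∀ f : (Fin d → ℝ) → (Fin d → ℝ) [⋀^Fin k]→L[ℝ] ℝ, ContDiff ℝ ∞ f →
      iteratedFDeriv ℝ j (extDeriv f) v =
        (ContinuousAlternatingMap.alternatizeUncurryFinCLM ℝ (Fin d → ℝ)
          ℝ).compContinuousMultilinearMap (iteratedFDeriv ℝ j (fderiv ℝ f) v) := fun f hf =>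
    ContinuousLinearMap.iteratedFDeriv_comp_left _
      (hf.fderiv_right (m := ∞) (by simp)).contDiffAt (by exact_mod_cast le_top)
  rw [key f hf, key g hg, h']

/-- The exterior variation `δ` of integrands: on each finite-dimensional family of fields it is
the exterior derivative with respect to the parameters. -/
def Integrand.δ (c : Domain IM M) (k : ℕ) :
    Integrand IE π c k →ₗ[ℝ] Integrand IE π c (k + 1) where
  toFun α :=
    ⟨fun d P v q => extDeriv (fun w => α.1 d P w q) v,
      { smooth := fun d P => contMDiff_extDeriv (α.2.smooth d P)
        pullback := fun d e P φ hφ w q => by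
          have h : (fun w => α.1 e (P.comp φ hφ) w q) = fun w =>
              (α.1 d P (φ w) q).compContinuousLinearMap (fderiv ℝ φ w) :=
            funext fun w => α.2.pullback d e P φ hφ w q
          change extDeriv (fun w => α.1 e (P.comp φ hφ) w q) w = _
          rw [h]
          exact extDeriv_pullback (r := ∞)
            ((α.2.contDiff P q).differentiable (by simp)).differentiableAt
            hφ.contDiffAt (by
              rw [minSmoothness_of_isRCLikeNormedField]
              exact WithTop.coe_le_coe.2 le_top)
        finite_order := by
          obtain ⟨r, hr⟩ := α.2.finite_order
          refine ⟨r + 1, fun d P P' v q s h j hj => ?_⟩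
          exact iteratedFDeriv_extDeriv_congr (α.2.contDiff P q) (α.2.contDiff P' q)
            (hr d P P' v q (s + 1) (fun i => (h i).mono (by omega)) (j + 1) (by omega)) }⟩
  map_add' α β := by
    ext1
    funext d P v q
    exact extDeriv_add ((α.2.contDiff P q).differentiable (by simp)).differentiableAt
      ((β.2.contDiff P q).differentiable (by simp)).differentiableAt
  map_smul' a α := by
    ext1
    funext d P v q
    exact extDeriv_smul a _

/-! ### Integrals of total divergences, relabelling of integration variables -/

/-- The derivative of a function along a vector field. -/
def dirDeriv (c : Domain IM M) (Y : ∀ q : c.Q, TangentSpace c.I q) (h : c.Q → ℝ) (q : c.Q) : ℝ :=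
  mfderiv c.I 𝓘(ℝ, ℝ) h q (Y q)

/-- The integrand `α` is a total divergence: `α μ` is the divergence of `β Y μ`, for a local
integrand `β` and a smooth vector field `Y` on `Q` (so in coordinates `α = ∑ D_a (f^a)`). The
divergence with respect to the measure `μ` is taken in the sense of distributions on `Q`. -/
def IsDivergence (c : Domain IM M) {k : ℕ} (α : Integrand IE π c k) : Prop :=
  ∃ (β : Integrand IE π c k) (Y : ∀ q : c.Q, TangentSpace c.I q),
    ContMDiff c.I c.I.tangent ∞ (fun q => (⟨q, Y q⟩ : TangentBundle c.I c.Q)) ∧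
    ∀ h : c.Q → ℝ, ContMDiff c.I 𝓘(ℝ, ℝ) ∞ h → HasCompactSupport h →
      ∀ (d : ℕ) (P : Family IM IE π d) (v : Fin d → ℝ),
        ∫ q, h q • α.1 d P v q ∂c.μ = - ∫ q, dirDeriv c Y h q • β.1 d P v q ∂c.μ

/-- The formal integrals of `α` over `c` and of `α'` over `c'` differ by a change of the
integration variables `φ : Q → Q'` and a renumbering `σ` of the evaluation points. -/
def IsRelabelling (c c' : Domain IM M) {k : ℕ} (α : Integrand IE π c k)
    (α' : Integrand IE π c' k) : Prop :=
  ∃ (φ : Diffeomorph c.I c'.I c.Q c'.Q ∞) (σ : c.ι ≃ c'.ι),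
    (∀ i q, c'.x (σ i) (φ q) = c.x i q) ∧
    ∀ h : c'.Q → ℝ, ContMDiff c'.I 𝓘(ℝ, ℝ) ∞ h → HasCompactSupport h →
      ∀ (d : ℕ) (P : Family IM IE π d) (v : Fin d → ℝ),
        ∫ q, h (φ q) • α.1 d P v q ∂c.μ = ∫ q, h q • α'.1 d P v q ∂c'.μ

theorem continuous_dirDeriv (c : Domain IM M) {Y : ∀ q : c.Q, TangentSpace c.I q}
    (hY : ContMDiff c.I c.I.tangent ∞ (fun q => (⟨q, Y q⟩ : TangentBundle c.I c.Q)))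
    {h : c.Q → ℝ} (hh : ContMDiff c.I 𝓘(ℝ, ℝ) ∞ h) : Continuous (dirDeriv c Y h) := by
  have : IsManifold c.I 1 c.Q := IsManifold.of_le (n := ∞) (by exact_mod_cast le_top)
  have h1 : ContMDiff c.I 𝓘(ℝ, ℝ).tangent ∞
      (fun q => tangentMap c.I 𝓘(ℝ, ℝ) h (⟨q, Y q⟩ : TangentBundle c.I c.Q)) :=
    (hh.contMDiff_tangentMap (m := ∞) (by simp)).comp hY
  exact ((contMDiff_snd_tangentBundle_modelSpace ℝ 𝓘(ℝ, ℝ)).comp h1).continuous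

theorem hasCompactSupport_dirDeriv (c : Domain IM M) (Y : ∀ q : c.Q, TangentSpace c.I q)
    {h : c.Q → ℝ} (hs : HasCompactSupport h) : HasCompactSupport (dirDeriv c Y h) := by
  refine hs.mono' fun q hq => ?_
  by_contra hn
  apply hq
  have h0 : h =ᶠ[𝓝 q] fun _ => (0 : ℝ) := notMem_tsupport_iff_eventuallyEq.mp hn
  change mfderiv c.I 𝓘(ℝ, ℝ) h q (Y q) = _
  rw [h0.mfderiv_eq, mfderiv_const]
  rfl

/-- Differentiation under the sign of a compactly supported integral. -/
theorem clm_fderiv_integral {N V F G : Type*} [TopologicalSpace N] [MeasurableSpace N]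
    [OpensMeasurableSpace N] [SecondCountableTopology N]
    [NormedAddCommGroup V] [NormedSpace ℝ V] [FiniteDimensional ℝ V]
    [NormedAddCommGroup F] [NormedSpace ℝ F] [NormedAddCommGroup G] [NormedSpace ℝ G]
    [CompleteSpace F] [CompleteSpace G] (μ : Measure N) [IsLocallyFiniteMeasure μ]
    (A : (V →L[ℝ] F) →L[ℝ] G) {f : V → N → F}
    (hc : Continuous (fun p : V × N => f p.1 p.2))
    (hdiff : ∀ q, Differentiable ℝ (fun w => f w q))
    (hD : Continuous (fun p : V × N => fderiv ℝ (fun w => f w p.2) p.1))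
    {h : N → ℝ} (hh : Continuous h) (hs : HasCompactSupport h) (v : V) :
    A (fderiv ℝ (fun w => ∫ q, h q • f w q ∂μ) v) =
      ∫ q, h q • A (fderiv ℝ (fun w => f w q) v) ∂μ := by
  have : ProperSpace V := FiniteDimensional.proper ℝ V
  have hcq : ∀ w, Continuous (fun q => h q • f w q) := fun w =>
    hh.smul (hc.comp (by fun_prop : Continuous fun q : N => (w, q)))
  have hDq : ∀ w, Continuous (fun q => h q • fderiv ℝ (fun v => f v q) w) := fun w =>
    hh.smul (hD.comp (by fun_prop : Continuous fun q : N => (w, q)))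
  obtain ⟨C, hC⟩ := ((isCompact_closedBall v 1).prod hs.isCompact).exists_bound_of_continuousOn
    hD.continuousOn
  have hint : Integrable (fun q => h q • fderiv ℝ (fun w => f w q) v) μ :=
    (hDq v).integrable_of_hasCompactSupport hs.smul_right
  have key : HasFDerivAt (fun w => ∫ q, h q • f w q ∂μ)
      (∫ q, h q • fderiv ℝ (fun w => f w q) v ∂μ) v := by
    refine hasFDerivAt_integral_of_dominated_of_fderiv_le (𝕜 := ℝ)
      (F := fun w q => h q • f w q) (F' := fun w q => h q • fderiv ℝ (fun w => f w q) w)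
      (bound := fun q => ‖h q‖ * C) (Metric.closedBall_mem_nhds v one_pos)
      (Filter.Eventually.of_forall fun w => (hcq w).aestronglyMeasurable)
      ((hcq v).integrable_of_hasCompactSupport hs.smul_right)
      (hDq v).aestronglyMeasurable ?_ ?_ ?_
    · refine Filter.Eventually.of_forall fun q w hw => ?_
      by_cases hq : q ∈ tsupport h
      · rw [norm_smul]
        exact mul_le_mul_of_nonneg_left (hC (w, q) ⟨hw, hq⟩) (norm_nonneg _)
      · simp [image_eq_zero_of_notMem_tsupport hq]
    · exact (hh.norm.mul continuous_const).integrable_of_hasCompactSupport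
        (hs.norm.mul_right)
    · exact Filter.Eventually.of_forall fun q w _ =>
        ((hdiff q) w).hasFDerivAt.const_smul (h q)
  have e := A.integral_comp_comm hint
  rw [key.fderiv, ← e]
  simp only [map_smul]

theorem extDeriv_integral {N : Type*} [TopologicalSpace N] [MeasurableSpace N]
    [OpensMeasurableSpace N] [SecondCountableTopology N] {EN HN : Type*}
    [NormedAddCommGroup EN] [NormedSpace ℝ EN] [TopologicalSpace HN] [ChartedSpace HN N]
    {I : ModelWithCorners ℝ EN HN} [IsManifold I ∞ N] (μ : Measure N) [IsLocallyFiniteMeasure μ]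
    {d k : ℕ} {f : (Fin d → ℝ) → N → (Fin d → ℝ) [⋀^Fin k]→L[ℝ] ℝ}
    (hf : ContMDiff (𝓘(ℝ, Fin d → ℝ).prod I) 𝓘(ℝ, (Fin d → ℝ) [⋀^Fin k]→L[ℝ] ℝ) ∞
      (fun p : (Fin d → ℝ) × N => f p.1 p.2))
    {h : N → ℝ} (hh : Continuous h) (hs : HasCompactSupport h) (v : Fin d → ℝ) :
    extDeriv (fun w => ∫ q, h q • f w q ∂μ) v = ∫ q, h q • extDeriv (fun w => f w q) v ∂μ :=
  clm_fderiv_integral μ (ContinuousAlternatingMap.alternatizeUncurryFinCLM ℝ (Fin d → ℝ) ℝ)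
    hf.continuous
    (fun q => ((hf.comp (contMDiff_id.prodMk contMDiff_const)).contDiff).differentiable (by simp))
    (contMDiff_partial_fderiv hf).continuous hh hs v

theorem integrable_smul_integrand (c : Domain IM M) {k : ℕ} (α : Integrand IE π c k)
    {h : c.Q → ℝ} (hh : Continuous h) (hs : HasCompactSupport h) {d : ℕ}
    (P : Family IM IE π d) (v : Fin d → ℝ) :
    Integrable (fun q => h q • α.1 d P v q) c.μ :=
  (hh.smul ((α.2.smooth d P).continuous.comp
    (by fun_prop : Continuous fun q : c.Q => (v, q)))).integrable_of_hasCompactSupport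
      hs.smul_right

theorem mfderiv_lift (c : Domain IM M) (Y : ∀ q : c.Q, TangentSpace c.I q) {h : c.Q × ℝ → ℝ}
    (hh : ContMDiff (c.I.prod 𝓘(ℝ, ℝ)) 𝓘(ℝ, ℝ) ∞ h) (p : c.Q × ℝ) :
    mfderiv (c.I.prod 𝓘(ℝ, ℝ)) 𝓘(ℝ, ℝ) h p ((Y p.1, 0) : c.EQ × ℝ) =
      dirDeriv c Y (fun q => h (q, p.2)) p.1 := by
  have hm : MDifferentiableAt (c.I.prod 𝓘(ℝ, ℝ)) 𝓘(ℝ, ℝ) h p := (hh p).mdifferentiableAt (by simp)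
  refine (mfderiv_prod_eq_add_apply (v := ((Y p.1, 0) : c.EQ × ℝ)) hm).trans ?_
  have hz : mfderiv 𝓘(ℝ, ℝ) 𝓘(ℝ, ℝ) (fun t => h (p.1, t)) p.2 (0 : ℝ) = 0 := map_zero _
  exact (congrArg (fun z : ℝ => dirDeriv c Y (fun q => h (q, p.2)) p.1 + z) hz).trans
    (add_zero _)

theorem isClosedEmbedding_prodMk_right {N : Type*} [TopologicalSpace N] [T2Space N] (t : ℝ) :
    Topology.IsClosedEmbedding (fun q : N => (q, t)) :=
  (show Function.LeftInverse (Prod.fst : N × ℝ → N) (fun q => (q, t)) from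
    fun _ => rfl).isClosedEmbedding continuous_fst (by fun_prop)

theorem IsDivergence.δ {c : Domain IM M} {k : ℕ} {α : Integrand IE π c k}
    (h : IsDivergence c α) : IsDivergence c (Integrand.δ c k α) := by
  obtain ⟨β, Y, hY, hd⟩ := h
  refine ⟨Integrand.δ c k β, Y, hY, fun h hh hs d P v => ?_⟩
  have e1 := extDeriv_integral c.μ (α.2.smooth d P) hh.continuous hs v
  have e2 := extDeriv_integral c.μ (β.2.smooth d P) (continuous_dirDeriv c hY hh)
    (hasCompactSupport_dirDeriv c Y hs) v
  have e3 : (fun w => ∫ q, h q • α.1 d P w q ∂c.μ) =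
      (-1 : ℝ) • fun w => ∫ q, dirDeriv c Y h q • β.1 d P w q ∂c.μ := by
    funext w
    exact (hd h hh hs d P w).trans (neg_one_smul ℝ _).symm
  rw [e3, extDeriv_smul, e2] at e1
  exact e1.symm.trans (neg_one_smul ℝ _)

theorem IsRelabelling.δ {c c' : Domain IM M} {k : ℕ} {α : Integrand IE π c k}
    {α' : Integrand IE π c' k} (h : IsRelabelling c c' α α') :
    IsRelabelling c c' (Integrand.δ c k α) (Integrand.δ c' k α') := by
  obtain ⟨φ, σ, hx, hd⟩ := h
  refine ⟨φ, σ, hx, fun h hh hs d P v => ?_⟩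
  have e1 := extDeriv_integral c.μ (α.2.smooth d P) (h := fun q => h (φ q))
    (hh.continuous.comp φ.continuous) (hs.comp_homeomorph φ.toHomeomorph) v
  have e2 := extDeriv_integral c'.μ (α'.2.smooth d P) hh.continuous hs v
  have e3 : (fun w => ∫ q, h (φ q) • α.1 d P w q ∂c.μ) =
      fun w => ∫ q, h q • α'.1 d P w q ∂c'.μ := funext fun w => hd h hh hs d P w
  rw [e3, e2] at e1
  exact e1.symm

/-! ### The operator `K` on integrands -/

/-- The inclusion `ℝ^d → ℝ × ℝ^d = ℝ^(d+1)`, `w ↦ (0, w)`. -/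
def tailInclusion (d : ℕ) : (Fin d → ℝ) →L[ℝ] (Fin (d + 1) → ℝ) :=
  ContinuousLinearMap.pi (Fin.cons 0 fun i => ContinuousLinearMap.proj i)

theorem tailInclusion_apply {d : ℕ} (w : Fin d → ℝ) :
    tailInclusion d w = Fin.cons 0 w := by
  funext i
  refine Fin.cases ?_ (fun j => ?_) i <;> simp [tailInclusion]

theorem cons_eq_add {d : ℕ} (t : ℝ) (v : Fin d → ℝ) :
    (Fin.cons t v : Fin (d + 1) → ℝ) = tailInclusion d v + Pi.single 0 t := by
  rw [tailInclusion_apply]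
  funext i
  refine Fin.cases ?_ (fun j => ?_) i <;> simp

/-- The interior product of a `(k+1)`-form on `ℝ × ℝ^d` with `∂/∂t`, restricted to `ℝ^d`:
`(w_1, …, w_k) ↦ a(∂_t, w_1, …, w_k)`. -/
def contractTime (d k : ℕ) :
    ((Fin (d + 1) → ℝ) [⋀^Fin (k + 1)]→L[ℝ] ℝ) →L[ℝ] ((Fin d → ℝ) [⋀^Fin k]→L[ℝ] ℝ) :=
  (ContinuousAlternatingMap.compContinuousLinearMapCLM (tailInclusion d)).comp
    ((ContinuousLinearMap.apply ℝ _ (Pi.single 0 1 : Fin (d + 1) → ℝ)).comp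
      (ContinuousAlternatingMap.curryLeftLI (𝕜 := ℝ) (E := Fin (d + 1) → ℝ) (F := ℝ)
        (n := k)).toContinuousLinearMap)

theorem contractTime_apply {d k : ℕ} (a : (Fin (d + 1) → ℝ) [⋀^Fin (k + 1)]→L[ℝ] ℝ)
    (w : Fin k → Fin d → ℝ) :
    contractTime d k a w =
      a (Fin.cons (Pi.single 0 1) fun i => (Fin.cons 0 (w i) : Fin (d + 1) → ℝ)) := by
  simp only [← tailInclusion_apply]
  rfl

/-- The section `x ↦ u(x, t)` of `π` at time `t`, for a section `u` of the induced bundle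
`π × id : E × ℝ → M × ℝ`. -/
def Field.atTime (u : Field (IM.prod 𝓘(ℝ, ℝ)) (IE.prod 𝓘(ℝ, ℝ)) (Prod.map π (id : ℝ → ℝ)))
    (t : ℝ) : Field IM IE π where
  toFun x := (u.toFun (x, t)).1
  contMDiff := contMDiff_fst.comp (u.contMDiff.comp (contMDiff_id.prodMk contMDiff_const))
  section_eq x := congrArg Prod.fst (u.section_eq (x, t))

/-- A `d`-parameter family `u_v` of fields on `M × ℝ`, regarded as the `(1 + d)`-parameter family
`(t, v) ↦ u_v(·, t)` of fields on `M`. Its velocity along `∂/∂t` is `u̇_v`. -/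
def Family.timeFamily {d : ℕ}
    (P : Family (IM.prod 𝓘(ℝ, ℝ)) (IE.prod 𝓘(ℝ, ℝ)) (Prod.map π (id : ℝ → ℝ)) d) :
    Family IM IE π (d + 1) where
  field s := (P.field (Fin.tail s)).atTime (s 0)
  contMDiff := by
    have h1 : ContMDiff 𝓘(ℝ, Fin (d + 1) → ℝ) 𝓘(ℝ, Fin d → ℝ) ∞
        (fun s : Fin (d + 1) → ℝ => Fin.tail s) :=
      ContDiff.contMDiff (contDiff_pi.2 fun i => contDiff_apply ℝ ℝ i.succ)
    have h0 : ContMDiff 𝓘(ℝ, Fin (d + 1) → ℝ) 𝓘(ℝ, ℝ) ∞ (fun s : Fin (d + 1) → ℝ => s 0) :=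
      ContDiff.contMDiff (contDiff_apply ℝ ℝ 0)
    exact contMDiff_fst.comp (P.contMDiff.comp
      ((h1.comp contMDiff_fst).prodMk (contMDiff_snd.prodMk (h0.comp contMDiff_fst))))

theorem sameJet_timeFamily {d r : ℕ}
    {P P' : Family (IM.prod 𝓘(ℝ, ℝ)) (IE.prod 𝓘(ℝ, ℝ)) (Prod.map π (id : ℝ → ℝ)) d}
    {v : Fin d → ℝ} {x : M} {t : ℝ}
    (h : SameJet (𝓘(ℝ, Fin d → ℝ).prod (IM.prod 𝓘(ℝ, ℝ))) (IE.prod 𝓘(ℝ, ℝ)) r P.ev P'.ev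
      (v, (x, t))) :
    SameJet (𝓘(ℝ, Fin (d + 1) → ℝ).prod IM) IE r P.timeFamily.ev P'.timeFamily.ev
      (Fin.cons t v, x) := by
  intro γ hγ h0 φ hφ j hj
  have h1 : ContMDiff 𝓘(ℝ, Fin (d + 1) → ℝ) 𝓘(ℝ, Fin d → ℝ) ∞
      (fun s : Fin (d + 1) → ℝ => Fin.tail s) :=
    ContDiff.contMDiff (contDiff_pi.2 fun i => contDiff_apply ℝ ℝ i.succ)
  have h0' : ContMDiff 𝓘(ℝ, Fin (d + 1) → ℝ) 𝓘(ℝ, ℝ) ∞ (fun s : Fin (d + 1) → ℝ => s 0) :=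
    ContDiff.contMDiff (contDiff_apply ℝ ℝ 0)
  have hγ1 := contMDiff_fst.comp hγ
  have hγ2 := contMDiff_snd.comp hγ
  exact h (fun s => (Fin.tail (γ s).1, ((γ s).2, (γ s).1 0)))
    ((h1.comp hγ1).prodMk (hγ2.prodMk (h0'.comp hγ1))) (by simp [h0])
    (fun p => φ p.1) (hφ.comp contMDiff_fst) j hj

variable [T2Space M]

theorem contDiff_cons_right {d : ℕ} (t : ℝ) :
    ContDiff ℝ ∞ (fun v : Fin d → ℝ => (Fin.cons t v : Fin (d + 1) → ℝ)) := by
  simp only [cons_eq_add]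
  exact (tailInclusion d).contDiff.add contDiff_const

theorem contDiff_cons {d : ℕ} :
    ContDiff ℝ ∞ (fun p : ℝ × (Fin d → ℝ) => (Fin.cons p.1 p.2 : Fin (d + 1) → ℝ)) := by
  refine contDiff_pi.2 fun i => ?_
  refine Fin.cases ?_ (fun j => ?_) i
  · simpa using contDiff_fst
  · simpa [Function.comp_def] using (contDiff_apply ℝ ℝ j).comp (contDiff_snd (E := ℝ) (F := Fin d → ℝ) (𝕜 := ℝ) (n := ∞))

theorem contDiff_tail {d : ℕ} : ContDiff ℝ ∞ (fun s : Fin (d + 1) → ℝ => Fin.tail s) :=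
  contDiff_pi.2 fun i => contDiff_apply ℝ ℝ i.succ

/-- The operator `K` on integrands. On a family `u_v` of fields on `M × ℝ`, at `(q, t)`, it is the
interior product of `α` with the velocity `u̇_v` at time `t`. -/
def Integrand.K (c : Domain IM M) (k : ℕ) :
    Integrand IE π c (k + 1) →ₗ[ℝ]
      Integrand (IE.prod 𝓘(ℝ, ℝ)) (Prod.map π (id : ℝ → ℝ)) c.timesLine k where
  toFun α :=
    ⟨fun d P v p => contractTime d k (α.1 (d + 1) P.timeFamily (Fin.cons p.2 v) p.1),
      { smooth := fun d P => by
          have h1 : ContMDiff (𝓘(ℝ, Fin d → ℝ).prod (c.I.prod 𝓘(ℝ, ℝ)))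
              𝓘(ℝ, Fin (d + 1) → ℝ) ∞ (fun p : (Fin d → ℝ) × (c.Q × ℝ) =>
                (Fin.cons p.2.2 p.1 : Fin (d + 1) → ℝ)) := by
            have h2 : ContMDiff (𝓘(ℝ, Fin d → ℝ).prod (c.I.prod 𝓘(ℝ, ℝ)))
              𝓘(ℝ, ℝ × (Fin d → ℝ)) ∞ (fun p : (Fin d → ℝ) × (c.Q × ℝ) => (p.2.2, p.1)) :=
              (contMDiff_snd.comp contMDiff_snd).prodMk_space contMDiff_fst
            exact contDiff_cons.contMDiff.comp h2
          exact (contractTime d k).contMDiff.comp ((α.2.smooth (d + 1) P.timeFamily).comp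
            (h1.prodMk (contMDiff_fst.comp contMDiff_snd)))
        pullback := fun d e P φ hφ w p => by
          have hψ : ContDiff ℝ ∞ (fun s : Fin (e + 1) → ℝ =>
              (Fin.cons (s 0) (φ (Fin.tail s)) : Fin (d + 1) → ℝ)) :=
            contDiff_cons.comp ((contDiff_apply ℝ ℝ 0).prodMk (hφ.comp contDiff_tail))
          have hP : (P.comp φ hφ).timeFamily = P.timeFamily.comp _ hψ := rfl
          have hdiff := hφ.differentiable (by simp)
          have h0 : HasFDerivAt (fun s : Fin (e + 1) → ℝ =>
              (Fin.cons (s 0) (φ (Fin.tail s)) : Fin (d + 1) → ℝ))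
              (ContinuousLinearMap.pi (Fin.cons (ContinuousLinearMap.proj 0) fun i =>
                (ContinuousLinearMap.proj i).comp ((fderiv ℝ φ w).comp
                  (ContinuousLinearMap.pi fun j => ContinuousLinearMap.proj j.succ))))
              (Fin.cons p.2 w) := by
            refine hasFDerivAt_pi.2 fun i => ?_
            refine Fin.cases ?_ (fun j => ?_) i
            · exact (ContinuousLinearMap.proj (R := ℝ) (φ := fun _ : Fin (e + 1) => ℝ)
                0).hasFDerivAt
            · have ht : HasFDerivAt (fun s : Fin (e + 1) → ℝ => Fin.tail s)
                  (ContinuousLinearMap.pi fun j : Fin e =>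
                    ContinuousLinearMap.proj (R := ℝ) (φ := fun _ : Fin (e + 1) => ℝ) j.succ)
                  (Fin.cons p.2 w) := (ContinuousLinearMap.pi fun j : Fin e =>
                    ContinuousLinearMap.proj (R := ℝ) (φ := fun _ : Fin (e + 1) => ℝ)
                      j.succ).hasFDerivAt
              have hφ' : HasFDerivAt φ (fderiv ℝ φ w)
                  (Fin.tail (Fin.cons p.2 w : Fin (e + 1) → ℝ)) := by
                simpa using (hdiff w).hasFDerivAt
              have := hasFDerivAt_pi'.1 (hφ'.comp (Fin.cons p.2 w : Fin (e + 1) → ℝ) ht) j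
              simpa using this
          ext1 W
          rw [hP, α.2.pullback, contractTime_apply, h0.fderiv]
          simp only [ContinuousAlternatingMap.compContinuousLinearMap_apply, contractTime_apply,
            Fin.cons_zero, Fin.tail_cons]
          congr 1
          funext i
          refine Fin.cases ?_ (fun j => ?_) i
          · funext a
            refine Fin.cases ?_ (fun b => ?_) a
            · simp
            · simp only [ContinuousLinearMap.coe_pi', Fin.cons_succ,
                ContinuousLinearMap.coe_comp, Function.comp_apply,
                ContinuousLinearMap.proj_apply]
              exact congrFun (map_zero (fderiv ℝ φ w)) b
          · funext a
            refine Fin.cases ?_ (fun b => ?_) a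
            · simp
            · simp
        finite_order := by
          obtain ⟨r, hr⟩ := α.2.finite_order
          refine ⟨r, fun d P P' v p s h j hj => ?_⟩
          have e1 := hr (d + 1) P.timeFamily P'.timeFamily (Fin.cons p.2 v) p.1 s
            (fun i => sameJet_timeFamily (h i)) j hj
          have key : ∀ R : Family (IM.prod 𝓘(ℝ, ℝ)) (IE.prod 𝓘(ℝ, ℝ))
              (Prod.map π (id : ℝ → ℝ)) d,
              iteratedFDeriv ℝ j (fun w => contractTime d k
                (α.1 (d + 1) R.timeFamily (Fin.cons p.2 w) p.1)) v =
              (contractTime d k).compContinuousMultilinearMap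
                ((iteratedFDeriv ℝ j (fun s => α.1 (d + 1) R.timeFamily s p.1)
                  (Fin.cons p.2 v)).compContinuousLinearMap fun _ => tailInclusion d) := by
            intro R
            have hR := α.2.contDiff R.timeFamily p.1
            have h1 := (contractTime d k).iteratedFDeriv_comp_left (n := ∞) (x := v)
              (f := fun w => α.1 (d + 1) R.timeFamily (Fin.cons p.2 w) p.1)
              (hR.comp (contDiff_cons_right p.2)).contDiffAt (i := j)
              (by exact_mod_cast le_top)
            refine h1.trans ?_
            congr 1
            have h2 := (tailInclusion d).iteratedFDeriv_comp_right (n := ∞)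
              (f := fun s => α.1 (d + 1) R.timeFamily (s + Pi.single 0 p.2) p.1)
              (hR.comp (contDiff_id.add contDiff_const)) v (i := j) (by exact_mod_cast le_top)
            rw [iteratedFDeriv_comp_add_right (f := fun s => α.1 (d + 1) R.timeFamily s p.1) j] at h2
            simp only [cons_eq_add]
            exact h2
          refine (key P).trans (Eq.trans ?_ (key P').symm)
          rw [e1] }⟩
  map_add' α β := by
    ext1
    funext d P v q
    exact map_add (contractTime d k) _ _
  map_smul' a α := by
    ext1
    funext d P v q
    exact map_smul (contractTime d k) _ _

theorem integral_K (c : Domain IM M) {k : ℕ} (α : Integrand IE π c (k + 1))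
    {h : c.Q × ℝ → ℝ} (hh : Continuous h) (hs : HasCompactSupport h) {d : ℕ}
    (P : Family (IM.prod 𝓘(ℝ, ℝ)) (IE.prod 𝓘(ℝ, ℝ)) (Prod.map π (id : ℝ → ℝ)) d)
    (v : Fin d → ℝ) :
    ∫ p, h p • (Integrand.K c k α).1 d P v p ∂c.timesLine.μ =
      ∫ t : ℝ, contractTime d k
        (∫ q, h (q, t) • α.1 (d + 1) P.timeFamily (Fin.cons t v) q ∂c.μ) := by
  have : SFinite c.μ := inferInstance
  refine (integral_prod_symm _ (integrable_smul_integrand c.timesLine (Integrand.K c k α)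
    hh hs P v)).trans (integral_congr_ae (Filter.Eventually.of_forall fun t => ?_))
  have hst : HasCompactSupport (fun q => h (q, t)) :=
    hs.comp_isClosedEmbedding (isClosedEmbedding_prodMk_right t)
  have e := (contractTime d k).integral_comp_comm (integrable_smul_integrand c α
    (h := fun q => h (q, t)) (hh.comp (by fun_prop)) hst P.timeFamily (Fin.cons t v))
  simp only [map_smul] at e
  exact e

theorem IsDivergence.K {c : Domain IM M} {k : ℕ} {α : Integrand IE π c (k + 1)}
    (h : IsDivergence c α) : IsDivergence c.timesLine (Integrand.K c k α) := by
  obtain ⟨β, Y, hY, hd⟩ := h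
  have hT : ContMDiff c.timesLine.I c.timesLine.I.tangent ∞
      (fun p : c.timesLine.Q => (⟨p, ((Y p.1, 0) : c.EQ × ℝ)⟩ :
        TangentBundle c.timesLine.I c.timesLine.Q)) := by
    have : IsManifold c.I 1 c.Q := IsManifold.of_le (n := ∞) (by exact_mod_cast le_top)
    have h0 : ContMDiff 𝓘(ℝ, ℝ) 𝓘(ℝ, ℝ).tangent ∞
        (fun t : ℝ => (⟨t, 0⟩ : TangentBundle 𝓘(ℝ, ℝ) ℝ)) :=
      Bundle.contMDiff_zeroSection ℝ (TangentSpace 𝓘(ℝ, ℝ))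
    exact contMDiff_equivTangentBundleProd_symm.comp
      ((hY.comp contMDiff_fst).prodMk (h0.comp contMDiff_snd))
  refine ⟨Integrand.K c k β, fun p => ((Y p.1, 0) : c.EQ × ℝ), hT, fun h hh hs d P v => ?_⟩
  have hder : dirDeriv c.timesLine (fun p => ((Y p.1, 0) : c.EQ × ℝ)) h =
      fun p : c.Q × ℝ => dirDeriv c Y (fun q => h (q, p.2)) p.1 := by
    funext p
    exact mfderiv_lift c Y hh p
  have hs2 := hasCompactSupport_dirDeriv c.timesLine (fun p => ((Y p.1, 0) : c.EQ × ℝ)) hs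
  have hc2 := continuous_dirDeriv c.timesLine hT hh
  refine (integral_K c α hh.continuous hs P v).trans ?_
  rw [integral_K c β hc2 hs2 P v, ← integral_neg]
  congr 1
  funext t
  rw [← map_neg]
  congr 1
  simp only [hder]
  exact hd (fun q => h (q, t)) (hh.comp (contMDiff_id.prodMk contMDiff_const))
    (hs.comp_isClosedEmbedding (isClosedEmbedding_prodMk_right t)) _ _ _

theorem IsRelabelling.K {c c' : Domain IM M} {k : ℕ} {α : Integrand IE π c (k + 1)}
    {α' : Integrand IE π c' (k + 1)} (h : IsRelabelling c c' α α') :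
    IsRelabelling c.timesLine c'.timesLine (Integrand.K c k α) (Integrand.K c' k α') := by
  obtain ⟨φ, σ, hx, hd⟩ := h
  refine ⟨φ.prodCongr (Diffeomorph.refl 𝓘(ℝ, ℝ) ℝ ∞), σ, fun i p => ?_, fun h hh hs d P v => ?_⟩
  · exact Prod.ext (hx i p.1) rfl
  · have hs' : HasCompactSupport (fun p : c.Q × ℝ => h (φ p.1, p.2)) :=
      hs.comp_homeomorph (φ.toHomeomorph.prodCongr (Homeomorph.refl ℝ))
    have hh' : Continuous (fun p : c.Q × ℝ => h (φ p.1, p.2)) :=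
      hh.continuous.comp ((φ.continuous.comp continuous_fst).prodMk continuous_snd)
    refine (integral_K c α hh' hs' P v).trans (Eq.trans ?_
      (integral_K c' α' hh.continuous hs P v).symm)
    congr 1
    funext t
    congr 1
    exact hd (fun q => h (q, t)) (hh.comp (contMDiff_id.prodMk contMDiff_const))
      (hs.comp_isClosedEmbedding (isClosedEmbedding_prodMk_right t)) _ _ _

end Forms

/-! ### Forms on the space of fields -/

section FormSpaces

variable {EM HM M EE HE E : Type u}
  [NormedAddCommGroup EM] [NormedSpace ℝ EM] [TopologicalSpace HM]
  [NormedAddCommGroup EE] [NormedSpace ℝ EE] [TopologicalSpace HE]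
  [TopologicalSpace M] [ChartedSpace HM M] [TopologicalSpace E] [ChartedSpace HE E]

/-- Finite sums of formal integrals `∫_Q α dμ`, as expressions. -/
abbrev PreForm (IM : ModelWithCorners ℝ EM HM) (IE : ModelWithCorners ℝ EE HE) (π : E → M)
    (k : ℕ) : Type (u + 1) :=
  ⨁ c : Domain IM M, Integrand IE π c k

instance {IM : ModelWithCorners ℝ EM HM} {IE : ModelWithCorners ℝ EE HE} {π : E → M} {k : ℕ} :
    AddCommGroup (PreForm IM IE π k) :=
  Module.addCommMonoidToAddCommGroup ℝ

open scoped Classical in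
/-- The formal integral `∫_Q α dμ`, as an expression. -/
def PreForm.integral {IM : ModelWithCorners ℝ EM HM} {IE : ModelWithCorners ℝ EE HE} {π : E → M}
    {k : ℕ} (c : Domain IM M) : Integrand IE π c k →ₗ[ℝ] PreForm IM IE π k :=
  DirectSum.lof ℝ (Domain IM M) (fun c => Integrand IE π c k) c

/-- The expressions that represent zero: spanned by the integrals of total divergences and by the
differences of integrals related by a change of the integration variables. -/
def nullForms (IM : ModelWithCorners ℝ EM HM) (IE : ModelWithCorners ℝ EE HE) (π : E → M)
    (k : ℕ) : Submodule ℝ (PreForm IM IE π k) :=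
  Submodule.span ℝ
    ({θ | ∃ (c : Domain IM M) (α : Integrand IE π c k),
        IsDivergence c α ∧ θ = PreForm.integral c α} ∪
      {θ | ∃ (c c' : Domain IM M) (α : Integrand IE π c k) (α' : Integrand IE π c' k),
        IsRelabelling c c' α α' ∧ θ = PreForm.integral c α - PreForm.integral c' α'})

/-- The space `Ω^k(𝓔(M))` of `k`-forms on the space of sections of `π : E → M`. -/
abbrev Form (IM : ModelWithCorners ℝ EM HM) (IE : ModelWithCorners ℝ EE HE) (π : E → M)
    (k : ℕ) : Type (u + 1) :=
  PreForm IM IE π k ⧸ nullForms IM IE π k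

variable (IM : ModelWithCorners ℝ EM HM) (IE : ModelWithCorners ℝ EE HE) (π : E → M)

open scoped Classical in
/-- `δ` on expressions: `∫ α ↦ ∫ δα`. -/
def PreForm.δ (k : ℕ) : PreForm IM IE π k →ₗ[ℝ] PreForm IM IE π (k + 1) :=
  DirectSum.toModule ℝ (Domain IM M) _
    (fun c => (PreForm.integral c).comp (Integrand.δ c k))

theorem PreForm.δ_integral (k : ℕ) (c : Domain IM M) (α : Integrand IE π c k) :
    PreForm.δ IM IE π k (PreForm.integral c α) = PreForm.integral c (Integrand.δ c k α) := by
  simp only [PreForm.δ, PreForm.integral, DirectSum.toModule_lof, LinearMap.comp_apply]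

theorem nullForms_le_comap_δ (k : ℕ) :
    nullForms IM IE π k ≤ (nullForms IM IE π (k + 1)).comap (PreForm.δ IM IE π k) := by
  refine Submodule.span_le.2 ?_
  rintro θ (⟨c, α, h, rfl⟩ | ⟨c, c', α, α', h, rfl⟩)
  · exact Submodule.subset_span (Or.inl ⟨c, _, h.δ, PreForm.δ_integral IM IE π k c α⟩)
  · refine Submodule.subset_span (Or.inr ⟨c, c', _, _, h.δ, ?_⟩)
    rw [map_sub, PreForm.δ_integral, PreForm.δ_integral]

/-- The exterior variation `δ : Ω^k(𝓔(M)) → Ω^(k+1)(𝓔(M))`. -/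
def Form.δ (k : ℕ) : Form IM IE π k →ₗ[ℝ] Form IM IE π (k + 1) :=
  Submodule.mapQ _ _ (PreForm.δ IM IE π k) (nullForms_le_comap_δ IM IE π k)

variable [T2Space M]

open scoped Classical in
/-- `K` on expressions: `∫_Q α dμ ↦ ∫_(Q × ℝ) i_u̇ α dμ dt`. -/
def PreForm.K (k : ℕ) : PreForm IM IE π (k + 1) →ₗ[ℝ]
    PreForm (IM.prod 𝓘(ℝ, ℝ)) (IE.prod 𝓘(ℝ, ℝ)) (Prod.map π (id : ℝ → ℝ)) k :=
  DirectSum.toModule ℝ (Domain IM M) _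
    (fun c => (PreForm.integral c.timesLine).comp (Integrand.K c k))

theorem PreForm.K_integral (k : ℕ) (c : Domain IM M) (α : Integrand IE π c (k + 1)) :
    PreForm.K IM IE π k (PreForm.integral c α) =
      PreForm.integral c.timesLine (Integrand.K c k α) := by
  simp only [PreForm.K, PreForm.integral, DirectSum.toModule_lof, LinearMap.comp_apply]

theorem nullForms_le_comap_K (k : ℕ) :
    nullForms IM IE π (k + 1) ≤
      (nullForms (IM.prod 𝓘(ℝ, ℝ)) (IE.prod 𝓘(ℝ, ℝ)) (Prod.map π (id : ℝ → ℝ)) k).comap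
        (PreForm.K IM IE π k) := by
  refine Submodule.span_le.2 ?_
  rintro θ (⟨c, α, h, rfl⟩ | ⟨c, c', α, α', h, rfl⟩)
  · exact Submodule.subset_span
      (Or.inl ⟨c.timesLine, _, h.K, PreForm.K_integral IM IE π k c α⟩)
  · refine Submodule.subset_span (Or.inr ⟨c.timesLine, c'.timesLine, _, _, h.K, ?_⟩)
    rw [map_sub, PreForm.K_integral, PreForm.K_integral]

/-- The operator `K : Ω^(k+1)(𝓔(M)) → Ω^k(𝓔(M × ℝ))`: the interior product with the velocity `u̇`,
followed by formal integration over `t`. On `Ω^0(𝓔(M))` the operator `K` is zero. -/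
def Form.K (k : ℕ) : Form IM IE π (k + 1) →ₗ[ℝ]
    Form (IM.prod 𝓘(ℝ, ℝ)) (IE.prod 𝓘(ℝ, ℝ)) (Prod.map π (id : ℝ → ℝ)) k :=
  Submodule.mapQ _ _ (PreForm.K IM IE π k) (nullForms_le_comap_K IM IE π k)

end FormSpaces

end

end FieldForms

/-! A `d`-parameter family of sections over `M × ℝ` is the same as a `(1 + d)`-parameter family `(t,
v) ↦ u_v(·, t)` of sections of `π`. Pulled back to it, an integrand `α` becomes, for each `q`, an
ordinary form on `ℝ × ℝ^d`. There `K` contracts with `∂_t` and restricts to the slice of constant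
`t`, while `δ` is the exterior derivative, on `ℝ × ℝ^d` before `K` is applied and on `ℝ^d`
afterwards.

Cartan's formula `d i_∂t + i_∂t d = L_∂t`, restricted to a slice, therefore says that the integrand
of `δK + Kδ` is the derivative in `t` of `α` evaluated at `u_t`. In degree zero `i_∂t α = 0`, so
that `Kδ` alone is this derivative. These two facts are `extDeriv_contractTime_add` and
`contractTime_extDeriv_zero`.

A derivative in `t` is a total divergence on `Q × ℝ`, namely that of the local integrand `α|_{u_t}`
(`Integrand.atTime`) times the vector field `∂_t`. This is proved against compactly supported test
functions in `isDivergence_of_timeDeriv`: by Fubini, the integral over each line `{q} × ℝ` is that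
of the derivative of a compactly supported function. Integration by parts happens only along `t`,
where the measure is Lebesgue, so `μ` may be any locally finite measure. The two operators thus
anticommute only modulo divergences, which are zero in the space of forms. -/

namespace FieldForms

section TimeSlices

/-! ### Cartan's formula on `ℝ × ℝ^d` -/

theorem hasFDerivAt_cons_right {d : ℕ} (t : ℝ) (v : Fin d → ℝ) :
    HasFDerivAt (fun w : Fin d → ℝ => (Fin.cons t w : Fin (d + 1) → ℝ)) (tailInclusion d) v := by
  simp only [cons_eq_add]
  exact (tailInclusion d).hasFDerivAt.add_const _

theorem hasDerivAt_cons_left {d : ℕ} (t : ℝ) (v : Fin d → ℝ) :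
    HasDerivAt (fun r : ℝ => (Fin.cons r v : Fin (d + 1) → ℝ)) (Pi.single 0 1) t := by
  refine hasDerivAt_pi.2 fun i => ?_
  refine Fin.cases ?_ (fun j => ?_) i
  · exact hasDerivAt_id t
  · simpa using hasDerivAt_const t (v j)

/-- The pull-back of forms along the inclusion `ℝ^d → ℝ × ℝ^d`. -/
noncomputable def tailPullback (d k : ℕ) :
    ((Fin (d + 1) → ℝ) [⋀^Fin k]→L[ℝ] ℝ) →L[ℝ] ((Fin d → ℝ) [⋀^Fin k]→L[ℝ] ℝ) :=
  ContinuousAlternatingMap.compContinuousLinearMapCLM (tailInclusion d)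

theorem tailPullback_apply {d k : ℕ} (a : (Fin (d + 1) → ℝ) [⋀^Fin k]→L[ℝ] ℝ)
    (w : Fin k → Fin d → ℝ) :
    tailPullback d k a w = a fun i => (Fin.cons 0 (w i) : Fin (d + 1) → ℝ) := by
  simp only [← tailInclusion_apply]
  rfl

/-- Cartan's formula in degree zero: a function has no contraction with `∂_t`, so the term `d i_∂t`
is absent. The alternating sum defining `extDeriv` has a single term, so no differentiability is
required. -/
theorem contractTime_extDeriv_zero {d : ℕ}
    (f : (Fin (d + 1) → ℝ) → (Fin (d + 1) → ℝ) [⋀^Fin 0]→L[ℝ] ℝ) (s : Fin (d + 1) → ℝ) :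
    contractTime d 0 (extDeriv f s) = tailPullback d 0 (fderiv ℝ f s (Pi.single 0 1)) := by
  ext w
  rw [contractTime_apply, tailPullback_apply]
  simp only [extDeriv, ContinuousAlternatingMap.alternatizeUncurryFin_apply]
  simp only [Fin.sum_univ_succ, Fin.val_zero, pow_zero, one_smul, Fin.cons_zero,
    Fin.sum_univ_zero, add_zero]
  congr 1

/-- Cartan's formula for `∂/∂t` on `ℝ × ℝ^d`, restricted to `ℝ^d`. -/
theorem extDeriv_contractTime_add {d k : ℕ}
    {f : (Fin (d + 1) → ℝ) → (Fin (d + 1) → ℝ) [⋀^Fin (k + 1)]→L[ℝ] ℝ} {t : ℝ} {v : Fin d → ℝ}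
    (hf : DifferentiableAt ℝ f (Fin.cons t v)) :
    extDeriv (fun w => contractTime d k (f (Fin.cons t w))) v +
        contractTime d (k + 1) (extDeriv f (Fin.cons t v)) =
      tailPullback d (k + 1) (fderiv ℝ f (Fin.cons t v) (Pi.single 0 1)) := by
  have hd : fderiv ℝ (fun w => contractTime d k (f (Fin.cons t w))) v =
      (contractTime d k).comp ((fderiv ℝ f (Fin.cons t v)).comp (tailInclusion d)) :=
    ((contractTime d k).hasFDerivAt.comp v
      (hf.hasFDerivAt.comp v (hasFDerivAt_cons_right t v))).fderiv
  ext w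
  rw [ContinuousAlternatingMap.add_apply, contractTime_apply, tailPullback_apply]
  simp only [extDeriv, ContinuousAlternatingMap.alternatizeUncurryFin_apply, hd]
  -- The alternating sum for `extDeriv f` at `(∂_t, w_0, …, w_k)` splits into the term that
  -- differentiates along `∂_t`, which is the right-hand side, and the terms that differentiate
  -- along some `w_i`.
  rw [Fin.sum_univ_succ (n := k + 1)]
  simp only [Fin.cons_succ, Fin.val_succ, pow_succ, ContinuousLinearMap.comp_apply,
    contractTime_apply, tailInclusion_apply, Fin.val_zero, pow_zero, one_smul, Fin.cons_zero,
    mul_neg, mul_one, neg_smul, Finset.sum_neg_distrib]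
  -- In the latter terms `∂_t` stays in front and `w_i` is removed from position `i + 1`. The sign
  -- `(-1)^(i+1)` is opposite to that of the `i`-th term of the exterior derivative of the
  -- contraction, so the two sums cancel.
  have h : ∀ i : Fin (k + 1), i.succ.removeNth
        (Fin.cons (Pi.single 0 1) fun i => (Fin.cons 0 (w i) : Fin (d + 1) → ℝ) :
          Fin (k + 2) → Fin (d + 1) → ℝ) =
      Fin.cons (Pi.single 0 1) fun j => (Fin.cons 0 (i.removeNth w j) : Fin (d + 1) → ℝ) := by
    intro i
    funext j
    refine Fin.cases ?_ (fun j => ?_) j <;> simp [Fin.removeNth]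
  simp only [h]
  rw [add_comm, neg_add_cancel_right]
  rfl

/-! ### Evaluation of families and integrands at a time -/

variable {EM HM M EE HE E : Type u}
  [NormedAddCommGroup EM] [NormedSpace ℝ EM] [TopologicalSpace HM]
  [NormedAddCommGroup EE] [NormedSpace ℝ EE] [TopologicalSpace HE]
  [TopologicalSpace M] [ChartedSpace HM M] [TopologicalSpace E] [ChartedSpace HE E]
  {IM : ModelWithCorners ℝ EM HM} {IE : ModelWithCorners ℝ EE HE} {π : E → M}

/-- A family of fields on `M × ℝ`, restricted to the time `t`. -/
noncomputable def Family.atTime {d : ℕ}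
    (P : Family (IM.prod 𝓘(ℝ, ℝ)) (IE.prod 𝓘(ℝ, ℝ)) (Prod.map π (id : ℝ → ℝ)) d) (t : ℝ) :
    Family IM IE π d :=
  P.timeFamily.comp _ (contDiff_cons_right t)

/-- A curve in `ℝ^d × M` is completed by the constant time `t`, and a test function on `E` is
composed with the projection `E × ℝ → E`. The order of the jet is unchanged. -/
theorem sameJet_atTime {d r : ℕ}
    {P P' : Family (IM.prod 𝓘(ℝ, ℝ)) (IE.prod 𝓘(ℝ, ℝ)) (Prod.map π (id : ℝ → ℝ)) d}
    {v : Fin d → ℝ} {x : M} {t : ℝ}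
    (h : SameJet (𝓘(ℝ, Fin d → ℝ).prod (IM.prod 𝓘(ℝ, ℝ))) (IE.prod 𝓘(ℝ, ℝ)) r P.ev P'.ev
      (v, (x, t))) :
    SameJet (𝓘(ℝ, Fin d → ℝ).prod IM) IE r (P.atTime t).ev (P'.atTime t).ev (v, x) :=
  fun γ hγ h0 φ hφ j hj => h (fun s => ((γ s).1, ((γ s).2, t)))
    ((contMDiff_fst.comp hγ).prodMk ((contMDiff_snd.comp hγ).prodMk contMDiff_const))
    (by simp [h0]) (fun p => φ p.1) (hφ.comp contMDiff_fst) j hj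

/-- The families `P.atTime t` differ from one `t` to another, and locality alone says nothing of how
`α` varies among them. Compatibility with pull-backs expresses all of them through the single family
`P.timeFamily`, where `t` is one of the parameters. -/
theorem IsLocal.apply_atTime {c : Domain IM M} {k : ℕ} {α : PreIntegrand IM IE π c.Q k}
    (hα : IsLocal c α) {d : ℕ}
    (P : Family (IM.prod 𝓘(ℝ, ℝ)) (IE.prod 𝓘(ℝ, ℝ)) (Prod.map π (id : ℝ → ℝ)) d)
    (t : ℝ) (v : Fin d → ℝ) (q : c.Q) :
    α d (P.atTime t) v q = tailPullback d k (α (d + 1) P.timeFamily (Fin.cons t v) q) := by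
  rw [Family.atTime, hα.pullback, (hasFDerivAt_cons_right t v).fderiv]
  rfl

/-- This identifies the right-hand side of Cartan's formula with an honest derivative in `t`:
`tailPullback` is linear and does not depend on `t`, so it commutes with the derivative. -/
theorem IsLocal.hasDerivAt_atTime {c : Domain IM M} {k : ℕ} {α : PreIntegrand IM IE π c.Q k}
    (hα : IsLocal c α) {d : ℕ}
    (P : Family (IM.prod 𝓘(ℝ, ℝ)) (IE.prod 𝓘(ℝ, ℝ)) (Prod.map π (id : ℝ → ℝ)) d)
    (t : ℝ) (v : Fin d → ℝ) (q : c.Q) :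
    HasDerivAt (fun t => α d (P.atTime t) v q)
      (tailPullback d k (fderiv ℝ (fun s => α (d + 1) P.timeFamily s q) (Fin.cons t v)
        (Pi.single 0 1))) t := by
  simp only [hα.apply_atTime]
  have h := ((hα.contDiff P.timeFamily q).differentiable (by simp)
    (Fin.cons t v)).hasFDerivAt.comp_hasDerivAt t (hasDerivAt_cons_left t v)
  exact (tailPullback d k).hasFDerivAt.comp_hasDerivAt t h

variable [T2Space M]

/-- The integrand `α` at the section `u_t`, as an integrand on `Q × ℝ`. -/
noncomputable def Integrand.atTime (c : Domain IM M) (k : ℕ) (α : Integrand IE π c k) :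
    Integrand (IE.prod 𝓘(ℝ, ℝ)) (Prod.map π (id : ℝ → ℝ)) c.timesLine k :=
  ⟨fun d P v p => α.1 d (P.atTime p.2) v p.1,
    { smooth := fun d P => by
        have h1 : ContMDiff (𝓘(ℝ, Fin d → ℝ).prod (c.I.prod 𝓘(ℝ, ℝ)))
            𝓘(ℝ, Fin (d + 1) → ℝ) ∞ (fun p : (Fin d → ℝ) × (c.Q × ℝ) =>
              (Fin.cons p.2.2 p.1 : Fin (d + 1) → ℝ)) := by
          have h2 : ContMDiff (𝓘(ℝ, Fin d → ℝ).prod (c.I.prod 𝓘(ℝ, ℝ)))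
            𝓘(ℝ, ℝ × (Fin d → ℝ)) ∞ (fun p : (Fin d → ℝ) × (c.Q × ℝ) => (p.2.2, p.1)) :=
            (contMDiff_snd.comp contMDiff_snd).prodMk_space contMDiff_fst
          exact contDiff_cons.contMDiff.comp h2
        -- Joint smoothness in `v`, `q` and `t` is inherited from the smoothness of `α` on the
        -- single family `P.timeFamily`.
        simp only [α.2.apply_atTime]
        exact (tailPullback d k).contMDiff.comp ((α.2.smooth (d + 1) P.timeFamily).comp
          (h1.prodMk (contMDiff_fst.comp contMDiff_snd)))
      pullback := fun d e P φ hφ w p => α.2.pullback d e (P.atTime p.2) φ hφ w p.1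
      finite_order := by
        obtain ⟨r, hr⟩ := α.2.finite_order
        exact ⟨r, fun d P P' v p s h => hr d (P.atTime p.2) (P'.atTime p.2) v p.1 s
          fun i => sameJet_atTime (h i)⟩ }⟩

/-! ### Derivatives in `t` as total divergences -/

theorem contMDiff_timeVectorField (c : Domain IM M) :
    ContMDiff c.timesLine.I c.timesLine.I.tangent ∞
      (fun p : c.timesLine.Q => (⟨p, ((0, 1) : c.EQ × ℝ)⟩ :
        TangentBundle c.timesLine.I c.timesLine.Q)) := by
  have : IsManifold c.I 1 c.Q := IsManifold.of_le (n := ∞) (by exact_mod_cast le_top)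
  have h0 : ContMDiff c.I c.I.tangent ∞ (fun q : c.Q => (⟨q, 0⟩ : TangentBundle c.I c.Q)) :=
    Bundle.contMDiff_zeroSection ℝ (TangentSpace c.I)
  have h1 : ContMDiff 𝓘(ℝ, ℝ) 𝓘(ℝ, ℝ).tangent ∞
      (fun t : ℝ => (⟨t, (1 : ℝ)⟩ : TangentBundle 𝓘(ℝ, ℝ) ℝ)) := by
    rw [contMDiff_vectorSpace_iff_contDiff (V := fun _ : ℝ => (1 : ℝ))]
    exact contDiff_const
  -- Under the identification of the tangent bundle of `Q × ℝ` with the product of tangent bundles,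
  -- `∂_t` is the zero section paired with the constant field `1`.
  exact contMDiff_equivTangentBundleProd_symm.comp
    ((h0.comp contMDiff_fst).prodMk (h1.comp contMDiff_snd))

theorem hasDerivAt_dirDeriv_time (c : Domain IM M) {h : c.Q × ℝ → ℝ}
    (hh : ContMDiff (c.I.prod 𝓘(ℝ, ℝ)) 𝓘(ℝ, ℝ) ∞ h) (q : c.Q) (t : ℝ) :
    HasDerivAt (fun t => h (q, t))
      (dirDeriv c.timesLine (fun _ => ((0, 1) : c.EQ × ℝ)) h (q, t)) t := by
  have hm : MDifferentiableAt (c.I.prod 𝓘(ℝ, ℝ)) 𝓘(ℝ, ℝ) h (q, t) :=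
    (hh (q, t)).mdifferentiableAt (by simp)
  have e : dirDeriv c.timesLine (fun _ => ((0, 1) : c.EQ × ℝ)) h (q, t) =
      mfderiv 𝓘(ℝ, ℝ) 𝓘(ℝ, ℝ) (fun t => h (q, t)) t (1 : ℝ) := by
    -- The differential of `h` is the sum of its two partial differentials, and the one along `Q` is
    -- applied to the zero vector.
    refine (mfderiv_prod_eq_add_apply (v := ((0, 1) : c.EQ × ℝ)) hm).trans ?_
    have hz : mfderiv c.I 𝓘(ℝ, ℝ) (fun q => h (q, t)) q (0 : c.EQ) = 0 := map_zero _
    exact (congrArg (fun z : ℝ => z +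
      (show ℝ from mfderiv 𝓘(ℝ, ℝ) 𝓘(ℝ, ℝ) (fun t => h (q, t)) t (1 : ℝ))) hz).trans (zero_add _)
  have hd : ContDiff ℝ ∞ (fun t => h (q, t)) :=
    (hh.comp (contMDiff_const.prodMk contMDiff_id)).contDiff
  rw [e, mfderiv_eq_fderiv]
  exact (hd.differentiable (by simp) t).hasDerivAt

/-- The formal integral over `Q × ℝ` of a derivative with respect to `t` vanishes. -/
theorem isDivergence_of_timeDeriv {c : Domain IM M} {k : ℕ} (α : Integrand IE π c k)
    (γ : Integrand (IE.prod 𝓘(ℝ, ℝ)) (Prod.map π (id : ℝ → ℝ)) c.timesLine k)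
    (hγ : ∀ (d : ℕ) (P : Family (IM.prod 𝓘(ℝ, ℝ)) (IE.prod 𝓘(ℝ, ℝ))
      (Prod.map π (id : ℝ → ℝ)) d) (v : Fin d → ℝ) (q : c.Q) (t : ℝ),
      γ.1 d P v (q, t) = tailPullback d k
        (fderiv ℝ (fun s => α.1 (d + 1) P.timeFamily s q) (Fin.cons t v) (Pi.single 0 1))) :
    IsDivergence c.timesLine γ := by
  -- The flux is `α|_{u_t} ∂_t`, with `α|_{u_t}` as the local integrand and `∂_t` as the vector
  -- field.
  refine ⟨Integrand.atTime c k α, fun _ => ((0, 1) : c.EQ × ℝ), contMDiff_timeVectorField c,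
    fun h hh hs d P v => ?_⟩
  have : SFinite c.μ := inferInstance
  have hsd := hasCompactSupport_dirDeriv c.timesLine (fun _ => ((0, 1) : c.EQ × ℝ)) hs
  have hcd := continuous_dirDeriv c.timesLine (contMDiff_timeVectorField c) hh
  have i1 := integrable_smul_integrand c.timesLine γ hh.continuous hs P v
  have i2 := integrable_smul_integrand c.timesLine (Integrand.atTime c k α) hcd hsd P v
  -- With both terms on one side, the integrand is `h ∂_t(α|_{u_t}) + (∂_t h) α|_{u_t} = ∂_t(h
  -- α|_{u_t})`. Fubini with `t` as the inner variable then reduces the claim to each fixed `q`.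
  rw [eq_neg_iff_add_eq_zero]
  refine (integral_add i1 i2).symm.trans ?_
  refine (integral_prod _ (i1.add i2)).trans
    (integral_eq_zero_of_ae (Filter.Eventually.of_forall fun q => ?_))
  have hemb : Topology.IsClosedEmbedding (fun t : ℝ => ((q, t) : c.Q × ℝ)) :=
    (show Function.LeftInverse (Prod.snd : c.Q × ℝ → ℝ) (fun t => (q, t)) from
      fun _ => rfl).isClosedEmbedding continuous_snd (by fun_prop)
  -- Integrability on `Q × ℝ` gives integrability on only almost every line. Compact support
  -- restricts to the closed line `{q} × ℝ`, which gives it for every `q`.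
  have slice : ∀ {g : c.Q × ℝ → ℝ} (β : Integrand (IE.prod 𝓘(ℝ, ℝ)) (Prod.map π (id : ℝ → ℝ))
      c.timesLine k), Continuous g → HasCompactSupport g →
      Integrable (fun t : ℝ => g (q, t) • β.1 d P v (q, t)) := fun {g} β hg hgs =>
    ((hg.comp hemb.continuous).smul ((β.2.smooth d P).continuous.comp
      (continuous_const.prodMk hemb.continuous))).integrable_of_hasCompactSupport
      (hgs.comp_isClosedEmbedding hemb).smul_right
  -- An integrable function on `ℝ` with integrable derivative has derivative of integral zero.
  refine integral_eq_zero_of_hasDerivAt_of_integrable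
    (f := fun t : ℝ => h (q, t) • (Integrand.atTime c k α).1 d P v (q, t)) (fun t => ?_)
    ((slice γ hh.continuous hs).add (slice _ hcd hsd)) (slice _ hh.continuous hs)
  have hd := α.2.hasDerivAt_atTime P t v q
  rw [← hγ] at hd
  exact (hasDerivAt_dirDeriv_time c hh q t).smul hd

/-- The anticommutation at the level of integrands: it holds up to the derivative in `t` supplied by
Cartan's formula for the form `s ↦ α` on `ℝ × ℝ^d`, at fixed `q`. -/
theorem isDivergence_δ_K_add_K_δ (c : Domain IM M) (k : ℕ) (α : Integrand IE π c (k + 1)) :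
    IsDivergence c.timesLine (Integrand.δ c.timesLine k (Integrand.K c k α) +
      Integrand.K c (k + 1) (Integrand.δ c (k + 1) α)) :=
  isDivergence_of_timeDeriv α _ fun d P v q t => extDeriv_contractTime_add
    (f := fun s => α.1 (d + 1) P.timeFamily s q) (t := t) (v := v)
    ((α.2.contDiff P.timeFamily q).differentiable (by simp)).differentiableAt

theorem isDivergence_K_δ_zero (c : Domain IM M) (α : Integrand IE π c 0) :
    IsDivergence c.timesLine (Integrand.K c 0 (Integrand.δ c 0 α)) :=
  isDivergence_of_timeDeriv α _ fun _ _ _ _ _ => contractTime_extDeriv_zero _ _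

/-! ### Passage from integrands to forms -/

variable (IM IE π)

/-- By linearity a single formal integral suffices. Both compositions send an integral over `Q` to
one over the same domain `Q × ℝ`, so the integrands can be added and the sum is a divergence; no
change of variables is involved. -/
theorem preForm_δ_K_add_K_δ_mem (k : ℕ) (θ : PreForm IM IE π (k + 1)) :
    PreForm.δ (IM.prod 𝓘(ℝ, ℝ)) (IE.prod 𝓘(ℝ, ℝ)) (Prod.map π (id : ℝ → ℝ)) k
        (PreForm.K IM IE π k θ) + PreForm.K IM IE π (k + 1) (PreForm.δ IM IE π (k + 1) θ) ∈
      nullForms (IM.prod 𝓘(ℝ, ℝ)) (IE.prod 𝓘(ℝ, ℝ)) (Prod.map π (id : ℝ → ℝ)) (k + 1) := by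
  classical
  induction θ using DirectSum.induction_on with
  | zero => simp only [map_zero, add_zero, Submodule.zero_mem]
  | of c α =>
    have e : DirectSum.of (fun c => Integrand IE π c (k + 1)) c α = PreForm.integral c α := by
      simp only [PreForm.integral, DirectSum.lof_eq_of]
    rw [e, PreForm.K_integral, PreForm.δ_integral, PreForm.δ_integral, PreForm.K_integral,
      ← map_add]
    exact Submodule.subset_span (Or.inl ⟨_, _, isDivergence_δ_K_add_K_δ c k α, rfl⟩)
  | add x y hx hy =>
    simp only [map_add]
    rw [add_add_add_comm]
    exact Submodule.add_mem _ hx hy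

theorem preForm_K_δ_zero_mem (θ : PreForm IM IE π 0) :
    PreForm.K IM IE π 0 (PreForm.δ IM IE π 0 θ) ∈
      nullForms (IM.prod 𝓘(ℝ, ℝ)) (IE.prod 𝓘(ℝ, ℝ)) (Prod.map π (id : ℝ → ℝ)) 0 := by
  classical
  induction θ using DirectSum.induction_on with
  | zero => simp only [map_zero, Submodule.zero_mem]
  | of c α =>
    have e : DirectSum.of (fun c => Integrand IE π c 0) c α = PreForm.integral c α := by
      simp only [PreForm.integral, DirectSum.lof_eq_of]
    rw [e, PreForm.δ_integral, PreForm.K_integral]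
    exact Submodule.subset_span (Or.inl ⟨_, _, isDivergence_K_δ_zero c α, rfl⟩)
  | add x y hx hy =>
    simp only [map_add]
    exact Submodule.add_mem _ hx hy

end TimeSlices

end FieldForms

theorem theorem2
    {EM HM M EE HE E EF HF Φ : Type u}
    [NormedAddCommGroup EM] [NormedSpace ℝ EM] [FiniteDimensional ℝ EM] [TopologicalSpace HM]
    [NormedAddCommGroup EE] [NormedSpace ℝ EE] [FiniteDimensional ℝ EE] [TopologicalSpace HE]
    [NormedAddCommGroup EF] [NormedSpace ℝ EF] [FiniteDimensional ℝ EF] [TopologicalSpace HF]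
    (IM : ModelWithCorners ℝ EM HM) [IM.Boundaryless]
    (IE : ModelWithCorners ℝ EE HE) [IE.Boundaryless]
    (IF : ModelWithCorners ℝ EF HF) [IF.Boundaryless]
    [TopologicalSpace M] [T2Space M] [SecondCountableTopology M]
    [ChartedSpace HM M] [IsManifold IM ∞ M]
    [TopologicalSpace E] [T2Space E] [SecondCountableTopology E]
    [ChartedSpace HE E] [IsManifold IE ∞ E]
    [TopologicalSpace Φ] [ChartedSpace HF Φ] [IsManifold IF ∞ Φ]
    (π : E → M) (hπ : FieldForms.IsSmoothFiberBundle IM IE IF Φ π) :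
    (∀ k : ℕ,
      FieldForms.Form.δ (IM.prod 𝓘(ℝ, ℝ)) (IE.prod 𝓘(ℝ, ℝ)) (Prod.map π (id : ℝ → ℝ)) k ∘ₗ
          FieldForms.Form.K IM IE π k +
        FieldForms.Form.K IM IE π (k + 1) ∘ₗ FieldForms.Form.δ IM IE π (k + 1) = 0) ∧
    FieldForms.Form.K IM IE π 0 ∘ₗ FieldForms.Form.δ IM IE π 0 = 0 
:= by
  refine ⟨fun k => LinearMap.ext fun η => ?_, LinearMap.ext fun η => ?_⟩
  · obtain ⟨θ, rfl⟩ := Submodule.Quotient.mk_surjective _ η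
    -- On a representative `θ` the maps induced on quotients are computed by `PreForm.δ` and
    -- `PreForm.K`, so vanishing means membership in `nullForms`.
    exact (Submodule.Quotient.mk_eq_zero _).2
      (FieldForms.preForm_δ_K_add_K_δ_mem IM IE π k θ)
  · obtain ⟨θ, rfl⟩ := Submodule.Quotient.mk_surjective _ η
    exact (Submodule.Quotient.mk_eq_zero _).2 (FieldForms.preForm_K_δ_zero_mem IM IE π θ)
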